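/- **Model.** There are finitely many arms. Arm $i$ has a finite non-empty state space $\mathcal S_i$, rewards $r^i_k\ge 0$, and non-negative numbers $q^i(k,j)$ with $\sum_{j\ne k}q^i(k,j)\le 1$ such that the graph with edges $k\to j$ whenever $q^i(k,j)>0$ is strongly connected. Each escape probability $f^i_k:\{1,2,\dots\}\to[0,1]$ is non-decreasing and piecewise linear with a finite breakpoint set $\mathcal W^i_k\ni 1$ (linear between consecutive breakpoints, constant after the last one). At most one arm is played per time step. If arm $i$ is in state $k$ and is played $t\ge1$ steps after its previous play, it yields reward $r^i_k$ and moves to $j\neq k$ with probability $f^i_k(t)q^i(k,j)$, otherwise it stays in $k$; arms that are not played keep their state. If the most recently played arm was $l\ne i$, playing $i$ costs $c_l+s_i$, where $c_i,s_i\ge0$ are the costs of switching out of and into arm $i$; staying with the same arm, with or without idle steps in between, is free. All arms start with elapsed time $1$, and the start states may be chosen. Let $OPT$ be the supremum, over all start states and all (history-dependent, randomized) policies, of the upper long-run average expected reward net of switching costs. **Dual program (DualSwitch).** With $\Delta P^i_k=\sum_{j\ne k}q^i(k,j)(p^i_j-p^i_k)$, minimize $\lambda+\sum_i h_i$ over real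 $\lambda,h_i,p^i_k$ subject to, for all $i$, $k\in\mathcal S_i$, $t\in\mathcal W^i_k$, $$\text{(1)}\ \ \lambda+t h_i\ge r^i_k-c_i-s_i+f^i_k(t)\Delta P^i_k,\qquad \text{(2)}\ \ t(\lambda+h_i)\ge r^i_k+f^i_k(t)\Delta P^i_k,$$ and $\lambda=\sum_i h_i$, $\lambda\ge 0$, $h_i\ge0$. **BalancedIndex.** Fix an optimal solution of (DualSwitch) and discard the arms with $h_i=0$. Suppose that for every remaining arm $i$ and every $k\in\mathcal S_i$ some constraint (1) or (2) is tight at some $t\in\mathcal W^i_k$; let $t^i_k$ be the smallest such $t$. Call $k$ good if (2) is tight at $t=t^i_k$. Call an arm in state $k$ ready if at least $t^i_k$ steps have passed since its last play. Give index $2$ to the most recently played arm if its state is good, index $1$ to every other ready arm, index $-1$ to all remaining arms, and index $0$ to idling. At every step take an option of highest index, ties broken arbitrarily; if it is an arm that is not yet ready (this can only be the most recently played arm, in a good state), stick with it and idle until it is ready. **Theorem (BalancedIndex is a 2-approximation for Monotone bandits with switching costs).** (DualSwitch) has an optimal solution, and for every optimal solution the following holds. 1. If some arm $i$ with $h_i>0$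 has a state in which neither constraint is tight at any $t\in\mathcal W^i_k$, then there is a start state of arm $i$ from which playing arm $i$ at every step, whatever the states of the other arms, has lower long-run average net reward at least $OPT/2$. 2. Otherwise the BalancedIndex policy is well defined, and for every choice of start states and every tie-breaking its lower long-run average expected reward net of switching costs is at least $OPT/2$. -/

import Mathlib

open Filter

open scoped Classical in
/-- An instance of the Monotone bandit problem with additive switching costs.  Arm `i : ι` has the
finite state space `S i`.  Playing arm `i` in state `k`, when its previous play was `t ≥ 1` steps
ago, yields reward `r i k` and moves the arm to `j ≠ k` with probability `f i k t * q i k j`. -/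
structure MonotoneBandit (ι : Type*) [Fintype ι] (S : ι → Type*) [∀ i, Fintype (S i)] where
  /-- reward of a play -/
  r : ∀ i, S i → ℝ
  /-- escape probability `f i k t`, meaningful for `t ≥ 1` -/
  f : ∀ i, S i → ℕ → ℝ
  /-- `q i k j` is the probability of moving to `j ≠ k` given escape from `k`; the diagonal entries
  play no role -/
  q : ∀ i, S i → S i → ℝ
  /-- breakpoints of the piecewise linear function `f i k` -/
  W : ∀ i, S i → Finset ℕ
  /-- cost of switching out of an arm -/
  c : ι → ℝ
  /-- cost of switching into an arm -/
  s : ι → ℝ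
  r_nonneg : ∀ i k, 0 ≤ r i k
  f_nonneg : ∀ i k t, 1 ≤ t → 0 ≤ f i k t
  f_le_one : ∀ i k t, 1 ≤ t → f i k t ≤ 1
  /-- monotone property -/
  f_mono : ∀ i k t, 1 ≤ t → f i k t ≤ f i k (t + 1)
  q_nonneg : ∀ i k j, 0 ≤ q i k j
  q_sum_le : ∀ i k, ∑ j ∈ Finset.univ.erase k, q i k j ≤ 1
  /-- the graph with an edge `j → k` when `q i j k > 0` is strongly connected -/
  strongly_connected : ∀ i (j k : S i), Relation.ReflTransGen (fun a b => 0 < q i a b) j k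
  one_mem_W : ∀ i k, 1 ∈ W i k
  W_pos : ∀ i k, ∀ t ∈ W i k, 1 ≤ t
  /-- linear interpolation between consecutive breakpoints -/
  f_linear : ∀ i k, ∀ t₁ ∈ W i k, ∀ t₂ ∈ W i k, (∀ u ∈ W i k, u ≤ t₁ ∨ t₂ ≤ u) →
    ∀ t : ℕ, t₁ < t → t < t₂ →
      f i k t = (((t₂ : ℝ) - t) * f i k t₁ + ((t : ℝ) - t₁) * f i k t₂) / ((t₂ : ℝ) - t₁)
  /-- constant from the last breakpoint on -/
  f_const : ∀ i k, ∀ t₁ ∈ W i k, (∀ u ∈ W i k, u ≤ t₁) → ∀ t, t₁ ≤ t → f i k t = f i k t₁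
  c_nonneg : ∀ i, 0 ≤ c i
  s_nonneg : ∀ i, 0 ≤ s i

namespace MonotoneBandit

/-- Joint configuration: for every arm its state and the number of steps since its last play, and
the arm that was played most recently (`none` before the first play). -/
structure Config (ι : Type*) (S : ι → Type*) where
  state : ∀ i, S i
  age : ι → ℕ
  last : Option ι

/-- Initial configuration with start states `σ`. -/
def start {ι : Type*} {S : ι → Type*} (σ : ∀ i, S i) : Config ι S where
  state := σ
  age := fun _ => 1
  last := none

/-- No arm is played: all states stay the same. -/
def Config.idle {ι : Type*} {S : ι → Type*} (x : Config ι S) : Config ι S where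
  state := x.state
  age := fun i => x.age i + 1
  last := x.last

open scoped Classical in
/-- Arm `i` is played and its new state is `j`. -/
noncomputable def Config.play {ι : Type*} {S : ι → Type*} (x : Config ι S) (i : ι) (j : S i) :
    Config ι S where
  state := Function.update x.state i j
  age := fun l => if l = i then 1 else x.age l + 1
  last := some i

/-- A (randomized, history dependent) policy: given the past configurations and actions and the
current configuration, a distribution over the actions `some i` (play arm `i`) and `none` (idle).
At most one arm is played per step. -/
abbrev Policy (ι : Type*) (S : ι → Type*) :=
  List (Config ι S × Option ι) → Config ι S → PMF (Option ι)

/-- The policy that plays arm `i` at every step. -/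
noncomputable def repeatPlay {ι : Type*} (S : ι → Type*) (i : ι) : Policy ι S :=
  fun _ _ => PMF.pure (some i)

variable {ι : Type*} [Fintype ι] {S : ι → Type*} [∀ i, Fintype (S i)] (B : MonotoneBandit ι S)

open scoped Classical in
/-- Probability that arm `i`, played in state `k` after `t` steps, is in state `j` afterwards. -/
noncomputable def trans (i : ι) (k : S i) (t : ℕ) (j : S i) : ℝ :=
  if j = k then 1 - ∑ l ∈ Finset.univ.erase k, B.f i k t * B.q i k l
  else B.f i k t * B.q i k j

open scoped Classical in
/-- Switching cost incurred by playing arm `i` when the most recently played arm is `last`.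
Idling does not leave the arm, and the very first play pays the setup cost only. -/
noncomputable def switchCost (last : Option ι) (i : ι) : ℝ :=
  match last with
  | none => B.s i
  | some l => if l = i then 0 else B.c l + B.s i

/-- Expected total reward, net of switching costs, of `T` steps of the policy `π` from the
configuration `x` after the history `H`. -/
noncomputable def total (π : Policy ι S) :
    ℕ → List (Config ι S × Option ι) → Config ι S → ℝ
  | 0, _, _ => 0
  | T + 1, H, x =>
      ((π H x) none).toReal * total π T (H ++ [(x, none)]) x.idle +
      ∑ i : ι, ((π H x) (some i)).toReal *
        (B.r i (x.state i) - B.switchCost x.last i +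
          ∑ j : S i, B.trans i (x.state i) (x.age i) j *
            total π T (H ++ [(x, some i)]) (x.play i j))

/-- Expected net reward per step over the first `T` steps, with start states `σ`. -/
noncomputable def average (π : Policy ι S) (σ : ∀ i, S i) (T : ℕ) : ℝ :=
  B.total π T [] (start σ) / T

/-- Long-run average net reward, in the pessimistic sense. -/
noncomputable def lowerAverage (π : Policy ι S) (σ : ∀ i, S i) : EReal :=
  liminf (fun T : ℕ => ((B.average π σ T : ℝ) : EReal)) atTop

/-- Long-run average net reward, in the optimistic sense. -/
noncomputable def upperAverage (π : Policy ι S) (σ : ∀ i, S i) : EReal :=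
  limsup (fun T : ℕ => ((B.average π σ T : ℝ) : EReal)) atTop

/-- Optimal long-run average net reward over all policies and all choices of the start states. -/
noncomputable def optValue : EReal :=
  ⨆ (σ : ∀ i, S i) (π : Policy ι S), B.upperAverage π σ

/-- Values of the variables of the linear program (DualSwitch). -/
structure DualPoint (ι : Type*) (S : ι → Type*) where
  lam : ℝ
  h : ι → ℝ
  p : ∀ i, S i → ℝ

/-- Objective of (DualSwitch). -/
noncomputable def objective (D : DualPoint ι S) : ℝ := D.lam + ∑ i, D.h i

open scoped Classical in
/-- `ΔP i k = ∑_{j ≠ k} q i k j * (p i j - p i k)`. -/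
noncomputable def deltaP (D : DualPoint ι S) (i : ι) (k : S i) : ℝ :=
  ∑ j ∈ Finset.univ.erase k, B.q i k j * (D.p i j - D.p i k)

/-- Feasibility for (DualSwitch). -/
structure Feasible (D : DualPoint ι S) : Prop where
  switch : ∀ i k, ∀ t ∈ B.W i k,
    B.r i k - B.c i - B.s i + B.f i k t * B.deltaP D i k ≤ D.lam + t * D.h i
  stay : ∀ i k, ∀ t ∈ B.W i k,
    B.r i k + B.f i k t * B.deltaP D i k ≤ t * (D.lam + D.h i)
  balance : D.lam = ∑ i, D.h i
  lam_nonneg : 0 ≤ D.lam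
  h_nonneg : ∀ i, 0 ≤ D.h i

/-- `D` is an optimal solution of (DualSwitch). -/
def Optimal (D : DualPoint ι S) : Prop :=
  B.Feasible D ∧ ∀ D' : DualPoint ι S, B.Feasible D' → objective D ≤ objective D'

/-- The first constraint of (DualSwitch) is tight at `t`. -/
def SwitchTight (D : DualPoint ι S) (i : ι) (k : S i) (t : ℕ) : Prop :=
  D.lam + t * D.h i = B.r i k - B.c i - B.s i + B.f i k t * B.deltaP D i k

/-- The second constraint of (DualSwitch) is tight at `t`. -/
def StayTight (D : DualPoint ι S) (i : ι) (k : S i) (t : ℕ) : Prop :=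
  t * (D.lam + D.h i) = B.r i k + B.f i k t * B.deltaP D i k

/-- Every state of arm `i` has a tight constraint. -/
def ArmTight (D : DualPoint ι S) (i : ι) : Prop :=
  ∀ k : S i, ∃ t ∈ B.W i k, B.SwitchTight D i k t ∨ B.StayTight D i k t

/-- The smallest `t` for which some constraint of state `k` of arm `i` is tight. -/
noncomputable def waitTime (D : DualPoint ι S) (i : ι) (k : S i) : ℕ :=
  sInf {t | t ∈ B.W i k ∧ (B.SwitchTight D i k t ∨ B.StayTight D i k t)}

/-- The good states of arm `i`: the second constraint is tight at `waitTime`. -/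
def Good (D : DualPoint ι S) (i : ι) (k : S i) : Prop :=
  B.StayTight D i k (B.waitTime D i k)

open scoped Classical in
/-- The index of arm `i` in state `k`, last played `t` steps ago; `held` says that it is the most
recently played arm.  Arms with `h i = 0` are discarded; the arm at which the player is has the
highest index as long as its state is good; arms that have waited long enough are ready. -/
noncomputable def armIndex (D : DualPoint ι S) (i : ι) (k : S i) (t : ℕ) (held : Prop) : ℤ :=
  if D.h i ≤ 0 then -1
  else if held ∧ B.Good D i k then 2
  else if B.waitTime D i k ≤ t then 1
  else -1

/-- The index of an action; idling is a dummy arm of index `0`. -/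
noncomputable def index (D : DualPoint ι S) (x : Config ι S) : Option ι → ℤ
  | none => 0
  | some i => B.armIndex D i (x.state i) (x.age i) (x.last = some i)

/-- The actions that the index rule permits: take an option of highest index (ties broken
arbitrarily); if it is an arm that has not yet waited for `waitTime` steps (necessarily the held
arm in a good state), stick with it without playing. -/
def Permitted (D : DualPoint ι S) (x : Config ι S) (a : Option ι) : Prop :=
  ∃ b : Option ι, (∀ b', B.index D x b' ≤ B.index D x b) ∧
    match b with
    | none => a = none
    | some i =>
        (B.waitTime D i (x.state i) ≤ x.age i ∧ a = some i) ∨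
        (x.age i < B.waitTime D i (x.state i) ∧ a = none)

/-- `π` is a BalancedIndex policy for the dual solution `D`. -/
def IsBalancedIndex (D : DualPoint ι S) (π : Policy ι S) : Prop :=
  ∀ H x, ∀ a ∈ (π H x).support, B.Permitted D x a

end MonotoneBandit

/-!
Both bounds compare a policy with a potential, that is a function of the configuration whose
expected change, added to the net reward of a step, is at most or at least a constant.

By piecewise linearity the constraints of (DualSwitch) hold at all times, not only at breakpoints.
Hence giving every elapsed step of arm `i` the value `h i`, and `lam` more while the arm is held,
yields a potential in which each step earns at most `lam + ∑ i, h i = 2 * lam`, so `OPT ≤ 2 * lam`.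
For BalancedIndex the same potential, with clocks stopped at `waitTime`, earns at least `lam` per
step: either an arm with a tight constraint is played, or an arm held in a good state ages, or all
arms with `h i > 0` age.

If an arm with `h i > 0` has a state without tight constraint, moving `p i` along a function whose
drift is negative at all other states makes the constraints of the arm strict, contradicting
optimality, unless some state is absorbing and pays at least `lam` whenever it is played.

An optimum exists by compactness: the maximum principle bounds the oscillation of `p i`, unless the
arm has an absorbing state, in which case `p i` can be chosen once and for all.
-/

section Drift

variable {α : Type*} [Fintype α] (Q : α → α → ℝ)

/-- The drift of a function on the states of a jump process with jump weights `Q`.  Diagonal weights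
contribute nothing, so `MonotoneBandit.deltaP` is the drift of `p i` under `q i`. -/
def drift : (α → ℝ) →ₗ[ℝ] α → ℝ where
  toFun v x := ∑ y, Q x y * (v y - v x)
  map_add' v w := by
    ext x
    simp only [Pi.add_apply, ← Finset.sum_add_distrib]
    exact Finset.sum_congr rfl fun y _ => by ring
  map_smul' c v := by
    ext x
    simp only [Pi.smul_apply, smul_eq_mul, RingHom.id_apply, Finset.mul_sum]
    exact Finset.sum_congr rfl fun y _ => by ring

theorem drift_apply (v : α → ℝ) (x : α) : drift Q v x = ∑ y, Q x y * (v y - v x) :=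
  rfl

theorem drift_apply_eq_sum_erase [DecidableEq α] (v : α → ℝ) (x : α) :
    drift Q v x = ∑ y ∈ Finset.univ.erase x, Q x y * (v y - v x) := by
  rw [drift_apply, Finset.sum_erase _ (by simp)]

theorem drift_const (c : ℝ) : drift Q (fun _ => c) = 0 := by
  ext x
  simp [drift_apply]

variable {Q}

/-- The maximum principle: around a maximum all terms of the drift are non-positive, so if their sum
is not negative then the maximum spreads along the edges until it reaches `a`. -/
theorem le_apply_of_drift_nonneg (hQ : ∀ x y, 0 ≤ Q x y) {a : α}
    (ha : ∀ x, Relation.ReflTransGen (fun x y => 0 < Q x y) x a) {v : α → ℝ}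
    (hv : ∀ x ≠ a, 0 ≤ drift Q v x) (x : α) : v x ≤ v a := by
  have : Nonempty α := ⟨a⟩
  obtain ⟨m, hm⟩ := Finite.exists_max v
  suffices hspread : ∀ y, (∀ z, v z ≤ v y) → v y ≤ v a from (hm x).trans (hspread m hm)
  intro y
  induction ha y using Relation.ReflTransGen.head_induction_on with
  | refl => exact fun _ => le_rfl
  | @head y z hyz _ ih =>
    intro hy
    rcases eq_or_ne y a with rfl | hya
    · exact le_rfl
    have hterm : ∀ w ∈ Finset.univ, Q y w * (v w - v y) ≤ 0 := fun w _ =>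
      mul_nonpos_of_nonneg_of_nonpos (hQ y w) (sub_nonpos.2 (hy w))
    have hzero : Q y z * (v z - v y) = 0 :=
      (Finset.sum_eq_zero_iff_of_nonpos hterm).1
        ((Finset.sum_nonpos hterm).antisymm (hv y hya)) z (Finset.mem_univ z)
    have hvz : v z = v y := sub_eq_zero.1 ((mul_eq_zero.1 hzero).resolve_left hyz.ne')
    exact hvz ▸ ih fun w => (hy w).trans_eq hvz.symm

/-- The maximum principle makes the linear system for `d` uniquely, hence always, solvable. -/
theorem exists_drift_eq_neg_one (hQ : ∀ x y, 0 ≤ Q x y) {a : α}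
    (ha : ∀ x, Relation.ReflTransGen (fun x y => 0 < Q x y) x a) :
    ∃ d : α → ℝ, d a = 0 ∧ ∀ x ≠ a, drift Q d x = -1 := by
  classical
  let L : (α → ℝ) →ₗ[ℝ] α → ℝ := LinearMap.pi fun x =>
    if x = a then LinearMap.proj a else LinearMap.proj x ∘ₗ drift Q
  have hLa : ∀ v, L v a = v a := fun v => by simp [L]
  have hL : ∀ v, ∀ x ≠ a, L v x = drift Q v x := fun v x hx => by simp [L, hx]
  have hle : ∀ v, L v = 0 → ∀ x, v x ≤ 0 := fun v hv x => by
    have hva : v a = 0 := by rw [← hLa v, hv, Pi.zero_apply]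
    exact hva ▸ le_apply_of_drift_nonneg hQ ha (fun y hy => by rw [← hL v y hy, hv]; rfl) x
  have hinj : Function.Injective L := (injective_iff_map_eq_zero L).2 fun v hv => by
    have hneg : L (-v) = 0 := by rw [map_neg, hv, neg_zero]
    ext x
    exact (hle v hv x).antisymm (neg_nonpos.1 (hle (-v) hneg x))
  obtain ⟨d, hd⟩ := LinearMap.injective_iff_surjective.1 hinj fun x => if x = a then 0 else -1
  exact ⟨d, by simp [← hLa d, hd], fun x hx => by simp [← hL d x hx, hd, hx]⟩

theorem exists_forall_sub_le_of_drift_le (hQ : ∀ x y, 0 ≤ Q x y)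
    (hconn : ∀ x y, Relation.ReflTransGen (fun x y => 0 < Q x y) x y) :
    ∃ M : ℝ, ∀ C : ℝ, 0 ≤ C → ∀ v, (∀ x, drift Q v x ≤ C) → ∀ x y, v x - v y ≤ C * M := by
  choose d hd₀ hd using fun a => exists_drift_eq_neg_one hQ fun x => hconn x a
  obtain ⟨M, hM⟩ := Finite.exists_le fun xy : α × α => d xy.1 xy.2
  refine ⟨M, fun C hC v hv x y => ?_⟩
  have hdrift : ∀ z ≠ x, 0 ≤ drift Q (-(v + C • d x)) z := fun z hz => by
    have hvz := hv z
    simp only [map_neg, map_add, map_smul, Pi.neg_apply, Pi.add_apply, Pi.smul_apply, hd x z hz,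
      smul_eq_mul]
    linarith
  have hmax := le_apply_of_drift_nonneg hQ (fun z => hconn z x) hdrift y
  simp only [Pi.neg_apply, Pi.add_apply, Pi.smul_apply, smul_eq_mul, hd₀] at hmax
  have hdM := mul_le_mul_of_nonneg_left (hM (x, y)) hC
  linarith

end Drift

theorem sum_toReal_apply_eq_one {α : Type*} [Fintype α] (μ : PMF α) : ∑ a, (μ a).toReal = 1 := by
  rw [← ENNReal.toReal_sum fun a _ => μ.apply_ne_top a, ← tsum_fintype (L := .unconditional _),
    μ.tsum_coe, ENNReal.toReal_one]

theorem sum_toReal_mul_mem_of_convex {α : Type*} [Fintype α] (μ : PMF α) {s : Set ℝ}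
    (hs : Convex ℝ s) {v : α → ℝ} (hv : ∀ a ∈ μ.support, v a ∈ s) :
    ∑ a, (μ a).toReal * v a ∈ s := by
  simpa only [finsum_eq_sum_of_fintype, smul_eq_mul] using
    hs.finsum_mem (w := fun a => (μ a).toReal) (z := v) (fun _ => ENNReal.toReal_nonneg)
      (by rw [finsum_eq_sum_of_fintype, sum_toReal_apply_eq_one])
      fun a ha => hv a ((μ.mem_support_iff a).2 fun h => ha (by simp [h]))

theorem eventually_add_mul_lt {a b c : ℝ} (hab : a ≤ b) (hc : a = b → c < 0) :
    ∀ᶠ ε in nhdsWithin (0 : ℝ) (Set.Ioi 0), a + ε * c < b := by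
  rcases hab.eq_or_lt with rfl | hlt
  · filter_upwards [self_mem_nhdsWithin] with ε hε
    exact add_lt_of_neg_right a (mul_neg_of_pos_of_neg hε (hc rfl))
  · have hcont : Continuous fun ε : ℝ => a + ε * c := by fun_prop
    exact nhdsWithin_le_nhds (hcont.continuousAt.eventually_lt continuousAt_const (by simpa))

theorem tendsto_average_linear (g K : ℝ) :
    Tendsto (fun T : ℕ => (T * g + K) / T) atTop (nhds g) := by
  have h : Tendsto (fun T : ℕ => g + K / T) atTop (nhds (g + 0)) :=
    tendsto_const_nhds.add (tendsto_const_div_atTop_nhds_zero_nat K)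
  refine (add_zero g ▸ h).congr' ?_
  filter_upwards [eventually_ne_atTop 0] with T hT
  field_simp

namespace MonotoneBandit

variable {ι : Type*} [Fintype ι] {S : ι → Type*} [∀ i, Fintype (S i)] (B : MonotoneBandit ι S)

/-! ### Escape probabilities and constraints between breakpoints -/

theorem monotoneOn_f (i : ι) (k : S i) : MonotoneOn (B.f i k) (Set.Ici 1) :=
  monotoneOn_nat_Ici_of_le_succ (B.f_mono i k)

theorem f_nonneg_of_mem {i : ι} {k : S i} {t : ℕ} (ht : t ∈ B.W i k) : 0 ≤ B.f i k t :=
  B.f_nonneg i k t (B.W_pos i k t ht)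

theorem one_le_cast_of_mem {i : ι} {k : S i} {t : ℕ} (ht : t ∈ B.W i k) : (1 : ℝ) ≤ t :=
  Nat.one_le_cast.2 (B.W_pos i k t ht)

theorem exists_breakpoint_interpolation (i : ι) (k : S i) {t : ℕ} (ht : 1 ≤ t) :
    (∃ t₁ ∈ B.W i k, t₁ ≤ t ∧ B.f i k t = B.f i k t₁) ∨
    ∃ t₁ ∈ B.W i k, ∃ t₂ ∈ B.W i k, t₁ < t ∧ t < t₂ ∧
      ((t₂ : ℝ) - t₁) * B.f i k t = (t₂ - t) * B.f i k t₁ + (t - t₁) * B.f i k t₂ := by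
  classical
  obtain ⟨t₁, ht₁, hmax⟩ := ((B.W i k).filter (· ≤ t)).exists_max_image id
    ⟨1, Finset.mem_filter.2 ⟨B.one_mem_W i k, ht⟩⟩
  simp only [Finset.mem_filter, id, and_imp] at ht₁ hmax
  obtain ⟨hW₁, hle⟩ := ht₁
  rcases ((B.W i k).filter (t < ·)).eq_empty_or_nonempty with hlast | hnext
  · refine .inl ⟨t₁, hW₁, hle, B.f_const i k t₁ hW₁ (fun u hu => hmax u hu ?_) t hle⟩
    exact not_lt.1 (Finset.filter_eq_empty_iff.1 hlast hu)
  · obtain ⟨t₂, ht₂, hmin⟩ := Finset.exists_min_image _ id hnext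
    simp only [Finset.mem_filter, id, and_imp] at ht₂ hmin
    obtain ⟨hW₂, hlt₂⟩ := ht₂
    rcases hle.eq_or_lt with rfl | hlt₁
    · exact .inl ⟨t₁, hW₁, le_rfl, rfl⟩
    refine .inr ⟨t₁, hW₁, t₂, hW₂, hlt₁, hlt₂, ?_⟩
    have hgap : (t₂ : ℝ) - t₁ ≠ 0 := sub_ne_zero.2 (by exact_mod_cast (hlt₁.trans hlt₂).ne')
    rw [B.f_linear i k t₁ hW₁ t₂ hW₂
      (fun u hu => (le_or_gt u t).imp (hmax u hu) (hmin u hu)) t hlt₁ hlt₂]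
    field_simp

theorem add_f_mul_le_of_breakpoints (i : ι) (k : S i) {a b m d : ℝ} (hm : 0 ≤ m)
    (hW : ∀ t ∈ B.W i k, a + B.f i k t * d ≤ b + t * m) {t : ℕ} (ht : 1 ≤ t) :
    a + B.f i k t * d ≤ b + t * m := by
  rcases B.exists_breakpoint_interpolation i k ht with
    ⟨t₁, hW₁, hle, hf⟩ | ⟨t₁, hW₁, t₂, hW₂, hlt₁, hlt₂, hf⟩
  · have hslope : (t₁ : ℝ) * m ≤ t * m := mul_le_mul_of_nonneg_right (Nat.cast_le.2 hle) hm
    rw [hf]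
    linarith [hW t₁ hW₁]
  · have hpos₁ : (0 : ℝ) < t - t₁ := sub_pos.2 (Nat.cast_lt.2 hlt₁)
    have hpos₂ : (0 : ℝ) < t₂ - t := sub_pos.2 (Nat.cast_lt.2 hlt₂)
    have hconv₁ := mul_le_mul_of_nonneg_left (hW t₁ hW₁) hpos₂.le
    have hconv₂ := mul_le_mul_of_nonneg_left (hW t₂ hW₂) hpos₁.le
    refine le_of_mul_le_mul_left ?_ (add_pos hpos₁ hpos₂)
    linear_combination hconv₁ + hconv₂ + d * hf

theorem deltaP_eq_drift (D : DualPoint ι S) (i : ι) (k : S i) :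
    B.deltaP D i k = drift (B.q i) (D.p i) k := by
  classical
  exact (drift_apply_eq_sum_erase ..).symm

section Feasible

variable {B} {D : DualPoint ι S}

theorem Feasible.switch_le (hD : B.Feasible D) (i : ι) (k : S i) {t : ℕ} (ht : 1 ≤ t) :
    B.r i k - B.c i - B.s i + B.f i k t * B.deltaP D i k ≤ D.lam + t * D.h i :=
  B.add_f_mul_le_of_breakpoints i k (hD.h_nonneg i) (hD.switch i k) ht

theorem Feasible.stay_le (hD : B.Feasible D) (i : ι) (k : S i) {t : ℕ} (ht : 1 ≤ t) :
    B.r i k + B.f i k t * B.deltaP D i k ≤ t * (D.lam + D.h i) := by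
  simpa only [zero_add] using B.add_f_mul_le_of_breakpoints i k (b := 0)
    (add_nonneg hD.lam_nonneg (hD.h_nonneg i)) (by simpa only [zero_add] using hD.stay i k) ht

theorem Feasible.objective_eq (hD : B.Feasible D) : objective D = 2 * D.lam := by
  rw [objective, ← hD.balance, two_mul]

theorem Feasible.h_le_lam (hD : B.Feasible D) (i : ι) : D.h i ≤ D.lam :=
  hD.balance ▸ Finset.single_le_sum (fun l _ => hD.h_nonneg l) (Finset.mem_univ i)

end Feasible

/-! ### Potentials and average rewards -/

theorem sum_trans_mul (i : ι) (k : S i) (t : ℕ) (v : S i → ℝ) :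
    ∑ j, B.trans i k t j * v j = v k + B.f i k t * drift (B.q i) v k := by
  classical
  have hmove : ∀ j ∈ Finset.univ.erase k,
      B.trans i k t j * v j = B.f i k t * (B.q i k j * v j) := fun j hj => by
    rw [trans, if_neg (Finset.ne_of_mem_erase hj), mul_assoc]
  have hstay : B.trans i k t k = 1 - B.f i k t * ∑ j ∈ Finset.univ.erase k, B.q i k j := by
    rw [trans, if_pos rfl, ← Finset.mul_sum]
  rw [← Finset.add_sum_erase _ _ (Finset.mem_univ k), Finset.sum_congr rfl hmove, hstay,
    drift_apply_eq_sum_erase]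
  simp only [mul_sub, Finset.sum_sub_distrib, ← Finset.sum_mul, ← Finset.mul_sum]
  ring

theorem sum_trans (i : ι) (k : S i) (t : ℕ) : ∑ j, B.trans i k t j = 1 := by
  simpa [drift_const] using B.sum_trans_mul i k t fun _ => 1

theorem trans_nonneg (i : ι) (k : S i) {t : ℕ} (ht : 1 ≤ t) (j : S i) : 0 ≤ B.trans i k t j := by
  unfold trans
  split_ifs
  · rw [← Finset.mul_sum, sub_nonneg]
    exact mul_le_one₀ (B.f_le_one i k t ht) (Finset.sum_nonneg fun l _ => B.q_nonneg i k l)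
      (B.q_sum_le i k)
  · exact mul_nonneg (B.f_nonneg i k t ht) (B.q_nonneg i k j)

/-- Every arm has a positive elapsed time, which is what makes `trans` a probability. -/
def Config.AgePos {ι : Type*} {S : ι → Type*} (x : Config ι S) : Prop :=
  ∀ i, 1 ≤ x.age i

/-- `B.Step x a y`: the action `a` leads from `x` to `y` with positive probability. -/
inductive Step (x : Config ι S) : Option ι → Config ι S → Prop
  | idle : Step x none x.idle
  | play {i : ι} {j : S i} : 0 < B.trans i (x.state i) (x.age i) j → Step x (some i) (x.play i j)

theorem agePos_start {ι : Type*} {S : ι → Type*} (σ : ∀ i, S i) : (start σ).AgePos :=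
  fun _ => le_rfl

variable {B} in
theorem Step.agePos {x y : Config ι S} {a : Option ι} (h : B.Step x a y) (hx : x.AgePos) :
    y.AgePos := by
  intro l
  cases h with
  | idle => exact (hx l).trans (Nat.le_succ _)
  | play => simp only [Config.play]; split_ifs <;> omega

/-- The expected net reward of the action `a` in `x` plus the expectation of `v` at the next
configuration. -/
noncomputable def stepValue (x : Config ι S) (v : Config ι S → ℝ) : Option ι → ℝ
  | none => v x.idle
  | some i => B.r i (x.state i) - B.switchCost x.last i +
      ∑ j, B.trans i (x.state i) (x.age i) j * v (x.play i j)

theorem total_succ (π : Policy ι S) (T : ℕ) (H : List (Config ι S × Option ι)) (x : Config ι S) :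
    B.total π (T + 1) H x =
      ∑ a, (π H x a).toReal * B.stepValue x (B.total π T (H ++ [(x, a)])) a := by
  simp only [total, stepValue, Fintype.sum_option]

theorem stepValue_const_add (x : Config ι S) (g : ℝ) (v : Config ι S → ℝ) (a : Option ι) :
    B.stepValue x (fun y => g + v y) a = g + B.stepValue x v a := by
  cases a with
  | none => rfl
  | some i =>
    simp only [stepValue, mul_add, Finset.sum_add_distrib, ← Finset.sum_mul, B.sum_trans, one_mul]
    ring

theorem stepValue_mono {x : Config ι S} (hx : x.AgePos) {a : Option ι} {v w : Config ι S → ℝ}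
    (h : ∀ y, B.Step x a y → v y ≤ w y) : B.stepValue x v a ≤ B.stepValue x w a := by
  cases a with
  | none => exact h _ .idle
  | some i =>
    refine add_le_add_right (Finset.sum_le_sum fun j _ => ?_) _
    rcases (B.trans_nonneg i (x.state i) (hx i) j).eq_or_lt with h0 | hpos
    · simp only [← h0, zero_mul, le_rfl]
    · exact mul_le_mul_of_nonneg_left (h _ (.play hpos)) hpos.le

theorem total_le_of_potential {Φ : Config ι S → ℝ} {g K : ℝ} (hΦ : ∀ x, x.AgePos → K ≤ Φ x)
    (hstep : ∀ x, x.AgePos → ∀ a, B.stepValue x Φ a ≤ g + Φ x) (π : Policy ι S) (T : ℕ)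
    (H : List (Config ι S × Option ι)) {x : Config ι S} (hx : x.AgePos) :
    B.total π T H x ≤ T * g + (Φ x - K) := by
  induction T generalizing H x with
  | zero => simpa [total] using hΦ x hx
  | succ T ih =>
    rw [total_succ]
    refine sum_toReal_mul_mem_of_convex _ (convex_Iic _) fun a _ => ?_
    calc B.stepValue x (B.total π T (H ++ [(x, a)])) a
        ≤ B.stepValue x (fun y => T * g - K + Φ y) a :=
          B.stepValue_mono hx fun y hy => (ih _ (hy.agePos hx)).trans_eq (by ring)
      _ = T * g - K + B.stepValue x Φ a := B.stepValue_const_add ..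
      _ ≤ T * g - K + (g + Φ x) := add_le_add_right (hstep x hx a) _
      _ = (T + 1 : ℕ) * g + (Φ x - K) := by push_cast; ring

theorem le_total_of_potential {Φ : Config ι S → ℝ} {g K : ℝ} {I : Config ι S → Prop}
    {π : Policy ι S} (hage : ∀ x, I x → x.AgePos) (hΦ : ∀ x, I x → Φ x ≤ K)
    (hinv : ∀ H x y, ∀ a ∈ (π H x).support, I x → B.Step x a y → I y)
    (hstep : ∀ H x, I x → ∀ a ∈ (π H x).support, g + Φ x ≤ B.stepValue x Φ a)
    (T : ℕ) (H : List (Config ι S × Option ι)) {x : Config ι S} (hx : I x) :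
    T * g + (Φ x - K) ≤ B.total π T H x := by
  induction T generalizing H x with
  | zero => simpa [total] using hΦ x hx
  | succ T ih =>
    rw [total_succ]
    refine sum_toReal_mul_mem_of_convex _ (convex_Ici _) fun a ha => ?_
    calc (T + 1 : ℕ) * g + (Φ x - K)
        = T * g - K + (g + Φ x) := by push_cast; ring
      _ ≤ T * g - K + B.stepValue x Φ a := add_le_add_right (hstep H x hx a ha) _
      _ = B.stepValue x (fun y => T * g - K + Φ y) a := (B.stepValue_const_add ..).symm
      _ ≤ B.stepValue x (B.total π T (H ++ [(x, a)])) a :=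
          B.stepValue_mono (hage x hx) fun y hy =>
            (ih _ (hinv H x y a ha hx hy)).trans_eq' (by ring)

theorem upperAverage_le {π : Policy ι S} {σ : ∀ i, S i} {g K : ℝ}
    (h : ∀ T : ℕ, B.total π T [] (start σ) ≤ T * g + K) : B.upperAverage π σ ≤ g := by
  rw [← ((continuous_coe_real_ereal.tendsto g).comp (tendsto_average_linear g K)).limsup_eq]
  exact limsup_le_limsup (Eventually.of_forall fun T =>
    EReal.coe_le_coe_iff.2 (div_le_div_of_nonneg_right (h T) T.cast_nonneg))

theorem le_lowerAverage {π : Policy ι S} {σ : ∀ i, S i} {g K : ℝ}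
    (h : ∀ T : ℕ, T * g + K ≤ B.total π T [] (start σ)) : (g : EReal) ≤ B.lowerAverage π σ := by
  rw [← ((continuous_coe_real_ereal.tendsto g).comp (tendsto_average_linear g K)).liminf_eq]
  exact liminf_le_liminf (Eventually.of_forall fun T =>
    EReal.coe_le_coe_iff.2 (div_le_div_of_nonneg_right (h T) T.cast_nonneg))

/-! ### Separable potentials -/

/-- The potential that adds up a contribution of each arm, which depends on its state, on its
elapsed time, and on whether it is held, i.e. the most recently played arm. -/
noncomputable def potential (φ : ∀ i, S i → ℕ → Prop → ℝ) (x : Config ι S) : ℝ :=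
  ∑ i, φ i (x.state i) (x.age i) (x.last = some i)

section Gains

variable (φ : ∀ i, S i → ℕ → Prop → ℝ)

open scoped Classical in
/-- What playing arm `i` earns in reward, setup cost and potential on arm `i` itself. -/
noncomputable def playGain (i : ι) (k : S i) (t : ℕ) (held : Prop) : ℝ :=
  B.r i k - (if held then 0 else B.s i) + ∑ j, B.trans i k t j * φ i j 1 True - φ i k t held

open scoped Classical in
/-- What playing another arm earns on arm `i`; the teardown cost is charged to the arm that was
held. -/
noncomputable def releaseGain (i : ι) (k : S i) (t : ℕ) (held : Prop) : ℝ :=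
  φ i k (t + 1) False - φ i k t held - if held then B.c i else 0

theorem stepValue_idle_sub (x : Config ι S) :
    B.stepValue x (potential φ) none - potential φ x =
      ∑ i, (φ i (x.state i) (x.age i + 1) (x.last = some i) -
        φ i (x.state i) (x.age i) (x.last = some i)) := by
  simp only [stepValue, potential, Finset.sum_sub_distrib, Config.idle]

open scoped Classical in
theorem switchCost_eq (last : Option ι) (i : ι) :
    B.switchCost last i = (if last = some i then 0 else B.s i) +
      ∑ l ∈ Finset.univ.erase i, if last = some l then B.c l else 0 := by
  rcases last with _ | l
  · simp [switchCost]
  · rcases eq_or_ne l i with rfl | h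
    · simp [switchCost]
    · simp [switchCost, h, add_comm]

omit [∀ i, Fintype (S i)] in
open scoped Classical in
theorem potential_play (x : Config ι S) (i : ι) (j : S i) :
    potential φ (x.play i j) =
      φ i j 1 True + ∑ l ∈ Finset.univ.erase i, φ l (x.state l) (x.age l + 1) False := by
  rw [potential, ← Finset.add_sum_erase _ _ (Finset.mem_univ i)]
  congr 1
  · simp [Config.play]
  · refine Finset.sum_congr rfl fun l hl => ?_
    have hli := Finset.ne_of_mem_erase hl
    simp [Config.play, hli, hli.symm]

open scoped Classical in
theorem stepValue_play_sub (x : Config ι S) (i : ι) :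
    B.stepValue x (potential φ) (some i) - potential φ x =
      B.playGain φ i (x.state i) (x.age i) (x.last = some i) +
        ∑ l ∈ Finset.univ.erase i,
          B.releaseGain φ l (x.state l) (x.age l) (x.last = some l) := by
  have hsplit : potential φ x = φ i (x.state i) (x.age i) (x.last = some i) +
      ∑ l ∈ Finset.univ.erase i, φ l (x.state l) (x.age l) (x.last = some l) :=
    (Finset.add_sum_erase _ _ (Finset.mem_univ i)).symm
  simp only [hsplit, stepValue, potential_play, switchCost_eq, playGain, releaseGain, mul_add,
    Finset.sum_add_distrib, ← Finset.sum_mul, sum_trans, one_mul, Finset.sum_sub_distrib]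
  ring_nf

end Gains

/-! ### Weak duality -/

open scoped Classical in
/-- The potential of an arm that certifies the objective value of the dual solution `D` as an upper
bound: every elapsed step is worth `h i`, and a further `lam` while the arm is held. -/
noncomputable def upperPotential (D : DualPoint ι S) (i : ι) (k : S i) (t : ℕ) (held : Prop) : ℝ :=
  D.p i k + D.h i * t + if held then D.lam * (t - 1) - B.c i else 0

open scoped Classical in
theorem upperPotential_succ (D : DualPoint ι S) (i : ι) (k : S i) (t : ℕ) (held : Prop) :
    B.upperPotential D i k (t + 1) held =
      B.upperPotential D i k t held + (D.h i + if held then D.lam else 0) := by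
  unfold upperPotential
  push_cast
  split_ifs <;> ring

theorem sum_trans_mul_upperPotential (D : DualPoint ι S) (i : ι) (k : S i) (t : ℕ) :
    ∑ j, B.trans i k t j * B.upperPotential D i j 1 True =
      D.p i k + B.f i k t * B.deltaP D i k + D.h i - B.c i := by
  have hφ : ∀ j, B.upperPotential D i j 1 True = D.p i j + (D.h i - B.c i) := fun j => by
    simp only [upperPotential, if_true, Nat.cast_one]
    ring
  simp only [hφ, mul_add, Finset.sum_add_distrib, ← Finset.sum_mul, sum_trans, sum_trans_mul,
    deltaP_eq_drift]
  ring

section WeakDuality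

variable {B} {D : DualPoint ι S}

theorem Feasible.playGain_upperPotential_le (hD : B.Feasible D) (i : ι) (k : S i) {t : ℕ}
    (ht : 1 ≤ t) (held : Prop) :
    B.playGain (B.upperPotential D) i k t held ≤ D.lam + D.h i := by
  have hswitch := hD.switch_le i k ht
  have hstay := hD.stay_le i k ht
  rw [playGain, sum_trans_mul_upperPotential, upperPotential]
  split_ifs <;> linarith

theorem Feasible.releaseGain_upperPotential_le (hD : B.Feasible D) (i : ι) (k : S i) {t : ℕ}
    (ht : 1 ≤ t) (held : Prop) : B.releaseGain (B.upperPotential D) i k t held ≤ D.h i := by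
  have hheld : 0 ≤ D.lam * ((t : ℝ) - 1) :=
    mul_nonneg hD.lam_nonneg (sub_nonneg.2 (Nat.one_le_cast.2 ht))
  simp only [releaseGain, upperPotential, if_false]
  push_cast
  split_ifs <;> linarith

theorem Feasible.stepValue_upperPotential_le (hD : B.Feasible D) {x : Config ι S} (hx : x.AgePos)
    (a : Option ι) :
    B.stepValue x (potential (B.upperPotential D)) a ≤
      objective D + potential (B.upperPotential D) x := by
  classical
  rw [← sub_le_iff_le_add]
  cases a with
  | none =>
    simp only [stepValue_idle_sub, upperPotential_succ, add_sub_cancel_left,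
      Finset.sum_add_distrib, objective, add_comm D.lam]
    refine add_le_add_right ?_ _
    cases x.last <;> simp [hD.lam_nonneg]
  | some i =>
    rw [stepValue_play_sub, objective, ← Finset.add_sum_erase _ _ (Finset.mem_univ i), ← add_assoc]
    exact add_le_add (hD.playGain_upperPotential_le i _ (hx i) _)
      (Finset.sum_le_sum fun l _ => hD.releaseGain_upperPotential_le l _ (hx l) _)

theorem Feasible.exists_le_potential_upperPotential (hD : B.Feasible D) :
    ∃ K, ∀ x : Config ι S, x.AgePos → K ≤ potential (B.upperPotential D) x := by
  choose m hm using fun i => Finite.exists_ge (D.p i)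
  refine ⟨∑ i, (m i - B.c i), fun x hx => Finset.sum_le_sum fun i _ => ?_⟩
  have hage : (1 : ℝ) ≤ x.age i := Nat.one_le_cast.2 (hx i)
  have hh := mul_nonneg (hD.h_nonneg i) (zero_le_one.trans hage)
  have hlam := mul_nonneg hD.lam_nonneg (sub_nonneg.2 hage)
  unfold upperPotential
  split_ifs <;> linarith [hm i (x.state i), B.c_nonneg i]

theorem Feasible.optValue_le (hD : B.Feasible D) : B.optValue ≤ objective D := by
  obtain ⟨K, hK⟩ := hD.exists_le_potential_upperPotential
  exact iSup₂_le fun σ π => B.upperAverage_le fun T =>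
    B.total_le_of_potential hK (fun x hx => hD.stepValue_upperPotential_le hx) π T []
      (agePos_start σ)

theorem Feasible.optValue_le_two_mul (hD : B.Feasible D) {v : EReal} (hv : (D.lam : EReal) ≤ v) :
    B.optValue ≤ 2 * v := by
  refine hD.optValue_le.trans ?_
  rw [hD.objective_eq, EReal.coe_mul]
  exact mul_le_mul_of_nonneg_left hv (by norm_num)

end WeakDuality

/-! ### The BalancedIndex policy -/

section BalancedIndex

variable {B} {D : DualPoint ι S}

theorem ArmTight.waitTime_spec {i : ι} (h : B.ArmTight D i) (k : S i) :
    B.waitTime D i k ∈ B.W i k ∧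
      (B.SwitchTight D i k (B.waitTime D i k) ∨ B.StayTight D i k (B.waitTime D i k)) :=
  Nat.sInf_mem (s := {t | t ∈ B.W i k ∧ (B.SwitchTight D i k t ∨ B.StayTight D i k t)}) (h k)

theorem ArmTight.one_le_waitTime {i : ι} (h : B.ArmTight D i) (k : S i) : 1 ≤ B.waitTime D i k :=
  B.W_pos i k _ (h.waitTime_spec k).1

/-- If the drift were negative, the tight first constraint would already be violated at time `1`
unless `waitTime` is `1`, and at time `1` the second constraint implies the first. -/
theorem Feasible.deltaP_nonneg_of_not_good (hD : B.Feasible D) {i : ι} (hi : 0 < D.h i)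
    (h : B.ArmTight D i) {k : S i} (hgood : ¬ B.Good D i k) : 0 ≤ B.deltaP D i k := by
  have hw := h.one_le_waitTime k
  have htight : B.SwitchTight D i k (B.waitTime D i k) := (h.waitTime_spec k).2.resolve_right hgood
  have hswitch := hD.switch_le i k le_rfl
  have hstay := hD.stay_le i k le_rfl
  simp only [SwitchTight, Nat.cast_one, one_mul] at htight hswitch hstay
  by_contra! hneg
  have hf := mul_le_mul_of_nonpos_right
    (B.monotoneOn_f i k (Set.mem_Ici.2 le_rfl) (Set.mem_Ici.2 hw) hw) hneg.le
  have hw_le : (B.waitTime D i k : ℝ) * D.h i ≤ 1 * D.h i := by linarith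
  have hw_eq : B.waitTime D i k = 1 :=
    le_antisymm (Nat.cast_le_one.1 (le_of_mul_le_mul_right hw_le hi)) hw
  refine hgood ?_
  simp only [Good, StayTight, hw_eq, Nat.cast_one, one_mul] at htight ⊢
  linarith [B.c_nonneg i, B.s_nonneg i]

theorem Feasible.le_reward_of_not_good (hD : B.Feasible D) {i : ι} (hi : 0 < D.h i)
    (h : B.ArmTight D i) {k : S i} (hgood : ¬ B.Good D i k) {t : ℕ} (ht : B.waitTime D i k ≤ t) :
    D.lam + B.waitTime D i k * D.h i + B.c i + B.s i ≤ B.r i k + B.f i k t * B.deltaP D i k := by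
  have hw := h.one_le_waitTime k
  have hf := mul_le_mul_of_nonneg_right
    (B.monotoneOn_f i k (Set.mem_Ici.2 hw) (Set.mem_Ici.2 (hw.trans ht)) ht)
    (hD.deltaP_nonneg_of_not_good hi h hgood)
  have htight : B.SwitchTight D i k (B.waitTime D i k) := (h.waitTime_spec k).2.resolve_right hgood
  unfold SwitchTight at htight
  linarith

open scoped Classical in
variable (B D) in
/-- The potential of an arm that certifies the lower bound for the BalancedIndex policy: its clock
stops at `waitTime`, and holding the arm is worth `lam` per step only in good states.  The penalty
for a good state that is not held pays for playing it; under the policy this happens only if the arm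
has not been played before. -/
noncomputable def lowerPotential (i : ι) (k : S i) (t : ℕ) (held : Prop) : ℝ :=
  D.p i k + D.h i * (min t (B.waitTime D i k) : ℕ) +
    if B.Good D i k then
      if held then D.lam * ((min t (B.waitTime D i k) : ℕ) - 1) - B.c i
      else -(D.lam + B.waitTime D i k * D.h i + B.c i + B.s i + |B.deltaP D i k|)
    else if held then -B.c i else 0

theorem Feasible.lowerPotential_mono (hD : B.Feasible D) (i : ι) (k : S i) (held : Prop) :
    Monotone fun t => B.lowerPotential D i k t held := by
  intro t u htu
  have hmin : ((min t (B.waitTime D i k) : ℕ) : ℝ) ≤ (min u (B.waitTime D i k) : ℕ) :=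
    Nat.cast_le.2 (min_le_min_right _ htu)
  have hh := mul_le_mul_of_nonneg_left hmin (hD.h_nonneg i)
  have hlam := mul_le_mul_of_nonneg_left hmin hD.lam_nonneg
  simp only [lowerPotential]
  split_ifs <;> linarith

theorem Feasible.lowerPotential_le (hD : B.Feasible D) (i : ι) (k : S i) (t : ℕ) (held : Prop) :
    B.lowerPotential D i k t held ≤ D.p i k + (D.lam + D.h i) * B.waitTime D i k := by
  have hmin : ((min t (B.waitTime D i k) : ℕ) : ℝ) ≤ B.waitTime D i k :=
    Nat.cast_le.2 (min_le_right _ _)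
  have hlam := hD.lam_nonneg
  have hh_min := mul_le_mul_of_nonneg_left hmin (hD.h_nonneg i)
  have hlam_min := mul_le_mul_of_nonneg_left hmin hlam
  have hh_wait := mul_nonneg (hD.h_nonneg i) (B.waitTime D i k).cast_nonneg
  have hlam_wait := mul_nonneg hlam (B.waitTime D i k).cast_nonneg
  unfold lowerPotential
  split_ifs <;> linarith [B.c_nonneg i, B.s_nonneg i, abs_nonneg (B.deltaP D i k)]

theorem Feasible.exists_potential_lowerPotential_le (hD : B.Feasible D) :
    ∃ K, ∀ x : Config ι S, potential (B.lowerPotential D) x ≤ K := by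
  choose m hm using fun i =>
    Finite.exists_le fun k => D.p i k + (D.lam + D.h i) * B.waitTime D i k
  exact ⟨∑ i, m i, fun x => Finset.sum_le_sum fun i _ =>
    (hD.lowerPotential_le i _ _ _).trans (hm i _)⟩

open scoped Classical in
theorem lowerPotential_succ_of_lt {i : ι} {k : S i} {t : ℕ} (ht : t < B.waitTime D i k)
    (held : Prop) :
    B.lowerPotential D i k (t + 1) held =
      B.lowerPotential D i k t held + (D.h i + if held ∧ B.Good D i k then D.lam else 0) := by
  simp only [lowerPotential, min_eq_left ht.le, min_eq_left (Nat.succ_le_of_lt ht), Nat.cast_succ]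
  by_cases hgood : B.Good D i k <;> by_cases hlast : held <;>
    simp only [hgood, hlast, and_true, and_false, if_true, if_false] <;> ring

theorem sum_trans_mul_lowerPotential {i : ι} (h : B.ArmTight D i) (k : S i) (t : ℕ) :
    ∑ j, B.trans i k t j * B.lowerPotential D i j 1 True =
      D.p i k + B.f i k t * B.deltaP D i k + D.h i - B.c i := by
  have hφ : ∀ j, B.lowerPotential D i j 1 True = D.p i j + (D.h i - B.c i) := fun j => by
    simp only [lowerPotential, min_eq_left (h.one_le_waitTime j), Nat.cast_one, if_true]
    split_ifs <;> ring
  simp only [hφ, mul_add, Finset.sum_add_distrib, ← Finset.sum_mul, sum_trans, sum_trans_mul,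
    deltaP_eq_drift]
  ring

theorem Feasible.le_playGain_lowerPotential (hD : B.Feasible D) {i : ι} (hi : 0 < D.h i)
    (h : B.ArmTight D i) {k : S i} {t : ℕ} (ht : B.waitTime D i k ≤ t) {held : Prop}
    (hheld : held → B.Good D i k → t ≤ B.waitTime D i k) :
    D.lam + D.h i ≤ B.playGain (B.lowerPotential D) i k t held := by
  rw [playGain, sum_trans_mul_lowerPotential h, lowerPotential, min_eq_right ht]
  by_cases hgood : B.Good D i k
  · by_cases hlast : held
    · have htight : B.StayTight D i k (B.waitTime D i k) := hgood
      unfold StayTight at htight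
      simp only [hgood, hlast, if_true, le_antisymm (hheld hlast hgood) ht]
      linarith
    · have ht₁ : 1 ≤ t := (h.one_le_waitTime k).trans ht
      have hjump : -|B.deltaP D i k| ≤ B.f i k t * B.deltaP D i k := by
        refine (neg_le_neg ?_).trans (neg_abs_le _)
        rw [abs_mul, abs_of_nonneg (B.f_nonneg i k t ht₁)]
        exact mul_le_of_le_one_left (abs_nonneg _) (B.f_le_one i k t ht₁)
      simp only [hgood, hlast, if_true, if_false]
      linarith [B.r_nonneg i k]
  · have hreward := hD.le_reward_of_not_good hi h hgood ht
    simp only [hgood, if_false]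
    split_ifs <;> linarith [B.c_nonneg i, B.s_nonneg i]

theorem Feasible.releaseGain_lowerPotential_nonneg (hD : B.Feasible D) {i : ι} {k : S i} {t : ℕ}
    {held : Prop} (hheld : held → ¬ B.Good D i k) :
    0 ≤ B.releaseGain (B.lowerPotential D) i k t held := by
  by_cases hlast : held
  · have hmono := hD.lowerPotential_mono i k True t.le_succ
    simp only [releaseGain, lowerPotential, hheld hlast, hlast, if_true, if_false] at hmono ⊢
    linarith
  · have hmono := hD.lowerPotential_mono i k False t.le_succ
    simp only [releaseGain, hlast, if_false, sub_zero, sub_nonneg]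
    exact hmono

theorem armIndex_nonneg_iff {i : ι} {k : S i} {t : ℕ} {held : Prop} :
    0 ≤ B.armIndex D i k t held ↔
      0 < D.h i ∧ (held ∧ B.Good D i k ∨ B.waitTime D i k ≤ t) := by
  rw [← not_le, armIndex]
  split_ifs <;> simp_all

theorem armIndex_pos_iff {i : ι} {k : S i} {t : ℕ} {held : Prop} :
    0 < B.armIndex D i k t held ↔
      0 < D.h i ∧ (held ∧ B.Good D i k ∨ B.waitTime D i k ≤ t) := by
  rw [← not_le (a := D.h i), armIndex]
  split_ifs <;> simp_all

theorem two_le_armIndex_iff {i : ι} {k : S i} {t : ℕ} {held : Prop} :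
    2 ≤ B.armIndex D i k t held ↔ 0 < D.h i ∧ held ∧ B.Good D i k := by
  rw [← not_le, armIndex]
  split_ifs <;> simp_all

theorem Permitted.of_play {x : Config ι S} {i : ι} (ha : B.Permitted D x (some i)) :
    0 < D.h i ∧ B.waitTime D i (x.state i) ≤ x.age i ∧
      ∀ l ≠ i, 0 < D.h l → x.last = some l → ¬ B.Good D l (x.state l) := by
  obtain ⟨_ | l, hmax, hb⟩ := ha
  · cases hb
  obtain ⟨hw, hil⟩ | ⟨-, hil⟩ := hb
  swap
  · cases hil
  obtain rfl : i = l := Option.some.inj hil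
  refine ⟨(armIndex_nonneg_iff.1 (hmax none)).1, hw, fun l hl hhl hlast hgood => hl ?_⟩
  have htwo := (two_le_armIndex_iff.2 ⟨hhl, hlast, hgood⟩).trans (hmax (some l))
  exact Option.some.inj (hlast.symm.trans (two_le_armIndex_iff.1 htwo).2.1)

theorem Permitted.of_idle {x : Config ι S} (ha : B.Permitted D x none) :
    (∃ i, x.last = some i ∧ B.Good D i (x.state i) ∧ x.age i < B.waitTime D i (x.state i)) ∨
    ∀ i, 0 < D.h i → x.age i < B.waitTime D i (x.state i) ∧
      ¬ (x.last = some i ∧ B.Good D i (x.state i)) := by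
  obtain ⟨_ | i, hmax, hb⟩ := ha
  · refine .inr fun i hi => ?_
    have hindex := mt armIndex_pos_iff.2 (hmax (some i)).not_gt
    simpa only [hi, true_and, not_or, not_le, and_comm] using hindex
  · obtain ⟨-, hi⟩ | ⟨hw, -⟩ := hb
    · cases hi
    · have hheld := (armIndex_nonneg_iff.1 (hmax none)).2.resolve_right hw.not_ge
      exact .inl ⟨i, hheld.1, hheld.2, hw⟩

variable (B D) in
/-- An invariant of the configurations that a BalancedIndex policy reaches: an arm held in a good
state is played as soon as it is ready. -/
structure Reachable (x : Config ι S) : Prop where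
  age : x.AgePos
  held : ∀ i, x.last = some i → 0 < D.h i
  good : ∀ i, x.last = some i → B.Good D i (x.state i) → x.age i ≤ B.waitTime D i (x.state i)

theorem reachable_start (σ : ∀ i, S i) : B.Reachable D (start σ) where
  age := agePos_start σ
  held _ h := nomatch h
  good _ h := nomatch h

theorem Reachable.step (hT : ∀ i, 0 < D.h i → B.ArmTight D i) {x y : Config ι S}
    {a : Option ι} (hx : B.Reachable D x) (ha : B.Permitted D x a) (hxy : B.Step x a y) :
    B.Reachable D y := by
  refine ⟨hxy.agePos hx.age, fun i hlast => ?_, fun i hlast hgood => ?_⟩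
  · cases hxy with
    | idle => exact hx.held i hlast
    | play =>
      cases Option.some.inj hlast
      exact ha.of_play.1
  · cases hxy with
    | idle =>
      obtain ⟨l, hl, -, hw⟩ | hnot := ha.of_idle
      · cases Option.some.inj (hl.symm.trans hlast)
        exact hw
      · exact absurd ⟨hlast, hgood⟩ (hnot i (hx.held i hlast)).2
    | play =>
      cases Option.some.inj hlast
      simpa [Config.play] using (hT i ha.of_play.1).one_le_waitTime _

theorem Feasible.le_stepValue_lowerPotential_none (hD : B.Feasible D) {x : Config ι S}
    (ha : B.Permitted D x none) :
    D.lam + potential (B.lowerPotential D) x ≤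
      B.stepValue x (potential (B.lowerPotential D)) none := by
  rw [← le_sub_iff_add_le, stepValue_idle_sub]
  have hmono : ∀ i, 0 ≤ B.lowerPotential D i (x.state i) (x.age i + 1) (x.last = some i) -
      B.lowerPotential D i (x.state i) (x.age i) (x.last = some i) := fun i =>
    sub_nonneg.2 (hD.lowerPotential_mono i _ _ (x.age i).le_succ)
  obtain ⟨i, hlast, hgood, hw⟩ | hnot := ha.of_idle
  · refine le_trans ?_ (Finset.single_le_sum (fun l _ => hmono l) (Finset.mem_univ i))
    rw [lowerPotential_succ_of_lt hw, add_sub_cancel_left, if_pos ⟨hlast, hgood⟩]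
    exact le_add_of_nonneg_left (hD.h_nonneg i)
  · rw [hD.balance]
    refine Finset.sum_le_sum fun i _ => ?_
    rcases (hD.h_nonneg i).eq_or_lt with hi | hi
    · exact hi ▸ hmono i
    · obtain ⟨hw, hng⟩ := hnot i hi
      rw [lowerPotential_succ_of_lt hw, add_sub_cancel_left, if_neg hng, add_zero]

theorem Feasible.le_stepValue_lowerPotential_some (hD : B.Feasible D)
    (hT : ∀ i, 0 < D.h i → B.ArmTight D i) {x : Config ι S} (hx : B.Reachable D x) {i : ι}
    (ha : B.Permitted D x (some i)) :
    D.lam + potential (B.lowerPotential D) x ≤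
      B.stepValue x (potential (B.lowerPotential D)) (some i) := by
  classical
  obtain ⟨hi, hw, hother⟩ := ha.of_play
  rw [← le_sub_iff_add_le, stepValue_play_sub]
  refine le_add_of_le_of_nonneg ?_ (Finset.sum_nonneg fun l hl => ?_)
  · exact (le_add_of_nonneg_right hi.le).trans
      (hD.le_playGain_lowerPotential hi (hT i hi) hw (hx.good i))
  · exact hD.releaseGain_lowerPotential_nonneg fun hlast =>
      hother l (Finset.ne_of_mem_erase hl) (hx.held l hlast) hlast

theorem IsBalancedIndex.le_lowerAverage {π : Policy ι S} (hπ : B.IsBalancedIndex D π)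
    (hD : B.Feasible D) (hT : ∀ i, 0 < D.h i → B.ArmTight D i) (σ : ∀ i, S i) :
    (D.lam : EReal) ≤ B.lowerAverage π σ := by
  obtain ⟨K, hK⟩ := hD.exists_potential_lowerPotential_le
  refine B.le_lowerAverage fun T => B.le_total_of_potential (I := B.Reachable D)
    (fun x hx => hx.age) (fun x _ => hK x) (fun H x y a ha hx => hx.step hT (hπ H x a ha))
    (fun H x hx a ha => ?_) T [] (reachable_start σ)
  cases a with
  | none => exact hD.le_stepValue_lowerPotential_none (hπ H x _ ha)
  | some i => exact hD.le_stepValue_lowerPotential_some hT hx (hπ H x _ ha)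

variable (B D) in
theorem exists_isBalancedIndex : ∃ π : Policy ι S, B.IsBalancedIndex D π := by
  have hperm : ∀ x : Config ι S, ∃ a, B.Permitted D x a := fun x => by
    obtain ⟨b, hb⟩ := Finite.exists_max (B.index D x)
    cases b with
    | none => exact ⟨none, none, hb, rfl⟩
    | some i =>
      rcases le_or_gt (B.waitTime D i (x.state i)) (x.age i) with hw | hw
      · exact ⟨some i, some i, hb, .inl ⟨hw, rfl⟩⟩
      · exact ⟨none, some i, hb, .inr ⟨hw, rfl⟩⟩
  choose a ha using hperm
  refine ⟨fun _ x => PMF.pure (a x), fun H x b hb => ?_⟩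
  rw [PMF.mem_support_pure_iff] at hb
  exact hb ▸ ha x

end BalancedIndex

/-! ### Existence of an optimal dual solution -/

/-- The constraints of (DualSwitch) for arm `i`, with dual variables `lam`, `h` and `p i = v`. -/
def ArmFeasible (i : ι) (lam h : ℝ) (v : S i → ℝ) : Prop :=
  ∀ k, ∀ t ∈ B.W i k, B.r i k - B.c i - B.s i + B.f i k t * drift (B.q i) v k ≤ lam + t * h ∧
    B.r i k + B.f i k t * drift (B.q i) v k ≤ t * (lam + h)

theorem feasible_iff (D : DualPoint ι S) : B.Feasible D ↔
    (∀ i, B.ArmFeasible i D.lam (D.h i) (D.p i)) ∧ D.lam = ∑ i, D.h i ∧ 0 ≤ D.lam ∧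
      ∀ i, 0 ≤ D.h i := by
  simp only [ArmFeasible, ← deltaP_eq_drift]
  exact ⟨fun h => ⟨fun i k t ht => ⟨h.switch i k t ht, h.stay i k t ht⟩, h.balance, h.lam_nonneg,
      h.h_nonneg⟩,
    fun ⟨harm, hbalance, hlam, hh⟩ => ⟨fun i k t ht => (harm i k t ht).1,
      fun i k t ht => (harm i k t ht).2, hbalance, hlam, hh⟩⟩

/-- Away from `k₀`, a large multiple of a function with drift `-1` makes both left-hand sides
non-positive; where the escape probability vanishes, the constraints do not involve `v`. -/
theorem exists_armFeasible_of_absorbing {i : ι} {k₀ : S i} (hk₀ : ∀ t ∈ B.W i k₀, B.f i k₀ t = 0) :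
    ∃ v', ∀ lam h v, 0 ≤ lam → 0 ≤ h → B.ArmFeasible i lam h v → B.ArmFeasible i lam h v' := by
  obtain ⟨d, -, hd⟩ :=
    exists_drift_eq_neg_one (B.q_nonneg i) fun k => B.strongly_connected i k k₀
  obtain ⟨N, hN⟩ :=
    Finite.exists_le fun a : Σ k, B.W i k => B.r i a.1 / B.f i a.1 a.2
  refine ⟨N • d, fun lam h v hlam hh hv k t ht => ?_⟩
  obtain ⟨hswitch, hstay⟩ := hv k t ht
  rcases (B.f_nonneg_of_mem ht).eq_or_lt with hf | hf
  · simp only [← hf, zero_mul] at hswitch hstay ⊢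
    exact ⟨hswitch, hstay⟩
  · have hk : k ≠ k₀ := fun hk => hf.ne' (by subst hk; exact hk₀ t ht)
    have hreward : B.r i k ≤ N * B.f i k t := (div_le_iff₀ hf).1 (hN ⟨k, t, ht⟩)
    have hth := mul_nonneg t.cast_nonneg hh
    have hstay_nonneg := mul_nonneg t.cast_nonneg (add_nonneg hlam hh)
    rw [map_smul, Pi.smul_apply, hd k hk, smul_eq_mul]
    constructor <;> linarith [B.c_nonneg i, B.s_nonneg i]

theorem exists_forall_drift_le {i : ι} (hf : ∀ k, ∃ t ∈ B.W i k, B.f i k t ≠ 0) (L : ℝ) :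
    ∃ C, 0 ≤ C ∧ ∀ lam h v, lam + h ≤ L → B.ArmFeasible i lam h v →
      ∀ k, drift (B.q i) v k ≤ C := by
  choose t ht hft using hf
  obtain ⟨C, hC⟩ := Finite.exists_le fun k => t k * L / B.f i k (t k)
  refine ⟨max C 0, le_max_right _ _, fun lam h v hL hv k => ?_⟩
  have hfpos := (B.f_nonneg_of_mem (ht k)).lt_of_ne' (hft k)
  have hbudget := mul_le_mul_of_nonneg_left hL ((t k).cast_nonneg (α := ℝ))
  have hdrift : drift (B.q i) v k * B.f i k (t k) ≤ t k * L := by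
    linarith [(hv k _ (ht k)).2, B.r_nonneg i k]
  exact (((le_div_iff₀ hfpos).2 hdrift).trans (hC k)).trans (le_max_left _ _)

theorem exists_bounded_armFeasible (i : ι) [Nonempty (S i)] (L : ℝ) :
    ∃ K, ∀ lam h v, 0 ≤ lam → 0 ≤ h → lam + h ≤ L → B.ArmFeasible i lam h v →
      ∃ v', (∀ k, |v' k| ≤ K) ∧ B.ArmFeasible i lam h v' := by
  by_cases habsorbing : ∃ k, ∀ t ∈ B.W i k, B.f i k t = 0
  · obtain ⟨k₀, hk₀⟩ := habsorbing
    obtain ⟨v', hv'⟩ := B.exists_armFeasible_of_absorbing hk₀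
    obtain ⟨K, hK⟩ := Finite.exists_le fun k => |v' k|
    exact ⟨K, fun lam h v hlam hh _ hv => ⟨v', hK, hv' lam h v hlam hh hv⟩⟩
  · push Not at habsorbing
    obtain ⟨C, hC, hdrift⟩ := B.exists_forall_drift_le habsorbing L
    obtain ⟨M, hM⟩ :=
      exists_forall_sub_le_of_drift_le (B.q_nonneg i) (B.strongly_connected i)
    let k₀ : S i := Classical.arbitrary _
    refine ⟨C * M, fun lam h v _ _ hL hv => ⟨v - fun _ => v k₀, fun k => ?_, ?_⟩⟩
    · have hosc := hM C hC v (hdrift lam h v hL hv)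
      exact abs_sub_le_iff.2 ⟨hosc k k₀, hosc k₀ k⟩
    · simpa only [ArmFeasible, map_sub, drift_const, sub_zero] using hv

theorem exists_feasible : ∃ D : DualPoint ι S, B.Feasible D := by
  obtain ⟨R, hR⟩ := Finite.exists_le fun a : Σ i, S i => B.r a.1 a.2
  let m := max R 0
  have hm : 0 ≤ m := le_max_right _ _
  have hsum : 0 ≤ ∑ _i : ι, m := Finset.sum_nonneg fun _ _ => hm
  refine ⟨⟨∑ _i, m, fun _ => m, fun _ => 0⟩, (B.feasible_iff _).2
    ⟨fun i k t ht => ?_, rfl, hsum, fun _ => hm⟩⟩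
  have hreward : B.r i k ≤ m := (hR ⟨i, k⟩).trans (le_max_left _ _)
  have ht₁ : (1 : ℝ) ≤ t := B.one_le_cast_of_mem ht
  have htm : m ≤ t * m := le_mul_of_one_le_left hm ht₁
  have htsum := mul_nonneg t.cast_nonneg hsum
  simp only [map_zero, Pi.zero_apply, mul_zero]
  constructor <;> linarith [B.c_nonneg i, B.s_nonneg i]

theorem isClosed_setOf_feasible :
    IsClosed {x : ℝ × (ι → ℝ) × (∀ i, S i → ℝ) | B.Feasible ⟨x.1, x.2.1, x.2.2⟩} := by
  simp only [feasible_iff, ArmFeasible, drift_apply, Set.ofPred_and, Set.ofPred_forall]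
  refine .inter (isClosed_iInter fun i => isClosed_iInter fun k => isClosed_iInter fun t =>
    isClosed_iInter fun _ => .inter (isClosed_le ?_ ?_) (isClosed_le ?_ ?_)) <|
    .inter (isClosed_eq ?_ ?_) <| .inter (isClosed_le ?_ ?_) <|
    isClosed_iInter fun i => isClosed_le ?_ ?_
  all_goals fun_prop

theorem exists_bounded_feasible [∀ i, Nonempty (S i)] (L : ℝ) :
    ∃ K : ι → ℝ, ∀ D : DualPoint ι S, B.Feasible D → D.lam ≤ L →
      ∃ p : ∀ i, S i → ℝ, (∀ i k, |p i k| ≤ K i) ∧ B.Feasible ⟨D.lam, D.h, p⟩ := by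
  choose K hK using fun i => B.exists_bounded_armFeasible i (L + L)
  refine ⟨K, fun D hD hL => ?_⟩
  obtain ⟨harm, hbalance, hlam, hh⟩ := (B.feasible_iff D).1 hD
  choose p hp hfeas using fun i => hK i D.lam (D.h i) (D.p i) hlam (hh i)
    (add_le_add hL ((hD.h_le_lam i).trans hL)) (harm i)
  exact ⟨p, hp, (B.feasible_iff _).2 ⟨hfeas, hbalance, hlam, hh⟩⟩

theorem exists_optimal [∀ i, Nonempty (S i)] : ∃ D : DualPoint ι S, B.Optimal D := by
  obtain ⟨D₀, hD₀⟩ := B.exists_feasible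
  obtain ⟨K, hK⟩ := B.exists_bounded_feasible D₀.lam
  let F : Set (ℝ × (ι → ℝ) × (∀ i, S i → ℝ)) :=
    Set.Icc (0, 0, fun i _ => -K i) (D₀.lam, fun _ => D₀.lam, fun i _ => K i) ∩
      {x | B.Feasible ⟨x.1, x.2.1, x.2.2⟩}
  have hF : IsCompact F := isCompact_Icc.inter_right B.isClosed_setOf_feasible
  have hmem : ∀ D : DualPoint ι S, B.Feasible D → D.lam ≤ D₀.lam → ∃ x ∈ F, x.1 = D.lam :=
    fun D hD hle => by
      obtain ⟨p, hp, hfeas⟩ := hK D hD hle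
      exact ⟨(D.lam, D.h, p), ⟨⟨⟨hD.lam_nonneg, hD.h_nonneg, fun i k => (abs_le.1 (hp i k)).1⟩,
        ⟨hle, fun i => (hD.h_le_lam i).trans hle, fun i k => (abs_le.1 (hp i k)).2⟩⟩, hfeas⟩, rfl⟩
  obtain ⟨x₀, hx₀, -⟩ := hmem D₀ hD₀ le_rfl
  obtain ⟨x, hx, hmin⟩ := hF.exists_isMinOn ⟨x₀, hx₀⟩ continuous_fst.continuousOn
  refine ⟨⟨x.1, x.2.1, x.2.2⟩, hx.2, fun D hD => ?_⟩
  rw [hx.2.objective_eq, hD.objective_eq]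
  refine mul_le_mul_of_nonneg_left ?_ zero_le_two
  rcases le_total D.lam D₀.lam with hle | hge
  · obtain ⟨y, hy, hlam⟩ := hmem D hD hle
    exact (hmin hy).trans_eq hlam
  · exact hx.1.2.1.trans hge

/-! ### Arms with a state without tight constraint -/

/-- All constraints of (DualSwitch) for arm `i` hold strictly, with dual variables `lam`, `h` and
`p i = v`. -/
def ArmStrict (i : ι) (lam h : ℝ) (v : S i → ℝ) : Prop :=
  ∀ k, ∀ t ∈ B.W i k, B.r i k - B.c i - B.s i + B.f i k t * drift (B.q i) v k < lam + t * h ∧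
    B.r i k + B.f i k t * drift (B.q i) v k < t * (lam + h)

section Perturbation

variable {B} {D : DualPoint ι S}

theorem ArmStrict.eventually_armFeasible {i : ι} {lam h : ℝ} {v : S i → ℝ}
    (hv : B.ArmStrict i lam h v) :
    ∀ᶠ y : ℝ × ℝ in nhds (lam, h), B.ArmFeasible i y.1 y.2 v := by
  refine eventually_all.2 fun k => (eventually_all_finset _).2 fun t ht => ?_
  have hswitch : Continuous fun y : ℝ × ℝ => y.1 + t * y.2 := by fun_prop
  have hstay : Continuous fun y : ℝ × ℝ => t * (y.1 + y.2) := by fun_prop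
  filter_upwards [continuousAt_const.eventually_lt hswitch.continuousAt (hv k t ht).1,
    continuousAt_const.eventually_lt hstay.continuousAt (hv k t ht).2] with y h₁ h₂
  exact ⟨h₁.le, h₂.le⟩

theorem ArmFeasible.shift {i : ι} {lam h δ : ℝ} {v : S i → ℝ} (hv : B.ArmFeasible i lam h v)
    (hδ : 0 ≤ δ) : B.ArmFeasible i (lam - δ) (h + δ) v := by
  intro k t ht
  have ht₁ : δ ≤ t * δ := le_mul_of_one_le_left hδ (B.one_le_cast_of_mem ht)
  constructor <;> linarith [(hv k t ht).1, (hv k t ht).2]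

/-- Moving `h i` down by `n * δ`, with `n` the number of arms, and every other `h l` up by `δ`
balances a decrease of `lam` by `δ`. -/
theorem Feasible.perturb [DecidableEq ι] (hD : B.Feasible D) {i : ι} {δ : ℝ} {v : S i → ℝ}
    (hδ : 0 ≤ δ) (hlam : 0 ≤ D.lam - δ) (hh : 0 ≤ D.h i - Fintype.card ι * δ)
    (hv : B.ArmFeasible i (D.lam - δ) (D.h i - Fintype.card ι * δ) v) :
    B.Feasible ⟨D.lam - δ, Function.update (fun l => D.h l + δ) i (D.h i - Fintype.card ι * δ),
      Function.update D.p i v⟩ := by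
  obtain ⟨harm, hbalance, -, hnonneg⟩ := (B.feasible_iff D).1 hD
  refine (B.feasible_iff _).2 ⟨fun l => ?_, ?_, hlam, fun l => ?_⟩
  · rcases eq_or_ne l i with rfl | hl
    · simpa only [Function.update_self] using hv
    · simpa only [Function.update_of_ne hl] using (harm l).shift hδ
  · have hsum := Finset.add_sum_erase Finset.univ (fun l => D.h l + δ) (Finset.mem_univ i)
    rw [Finset.sum_update_of_mem (Finset.mem_univ i), Finset.sdiff_singleton_eq_erase, hbalance]
    simp only [Finset.sum_add_distrib, Finset.sum_const, Finset.card_univ, nsmul_eq_mul] at hsum ⊢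
    linarith
  · rcases eq_or_ne l i with rfl | hl
    · simpa only [Function.update_self] using hh
    · simpa only [Function.update_of_ne hl] using add_nonneg (hnonneg l) hδ

theorem Optimal.not_armStrict (hD : B.Optimal D) {i : ι} (hi : 0 < D.h i) (v : S i → ℝ) :
    ¬ B.ArmStrict i D.lam (D.h i) v := by
  classical
  intro hv
  have hpath : Continuous fun δ : ℝ => (D.lam - δ, D.h i - Fintype.card ι * δ) := by fun_prop
  have hzero : Tendsto (fun δ : ℝ => (D.lam - δ, D.h i - Fintype.card ι * δ)) (nhds 0)
      (nhds (D.lam, D.h i)) := by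
    simpa using hpath.tendsto 0
  have hlam : ∀ᶠ y : ℝ × ℝ in nhds (D.lam, D.h i), 0 < y.1 :=
    continuousAt_const.eventually_lt continuousAt_fst (hi.trans_le (hD.1.h_le_lam i))
  have hh : ∀ᶠ y : ℝ × ℝ in nhds (D.lam, D.h i), 0 < y.2 :=
    continuousAt_const.eventually_lt continuousAt_snd hi
  obtain ⟨δ, ⟨hδlam, hδh, hδv⟩, hδ⟩ := (((hzero.mono_left nhdsWithin_le_nhds).eventually
    (hlam.and (hh.and hv.eventually_armFeasible))).and
      (self_mem_nhdsWithin : Set.Ioi (0 : ℝ) ∈ nhdsWithin 0 (Set.Ioi 0))).exists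
  have hD' := hD.1.perturb (le_of_lt hδ) hδlam.le hδh.le hδv
  have hobj := hD.2 _ hD'
  rw [hD.1.objective_eq, hD'.objective_eq] at hobj
  linarith [hobj, show 0 < δ from hδ]

theorem Feasible.exists_armStrict (hD : B.Feasible D) {i : ι} {d : S i → ℝ}
    (hd : ∀ k, ∀ t ∈ B.W i k, B.SwitchTight D i k t ∨ B.StayTight D i k t →
      B.f i k t * drift (B.q i) d k < 0) :
    ∃ v, B.ArmStrict i D.lam (D.h i) v := by
  have hev : ∀ᶠ ε in nhdsWithin (0 : ℝ) (Set.Ioi 0), ∀ k, ∀ t ∈ B.W i k,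
      B.r i k - B.c i - B.s i + B.f i k t * B.deltaP D i k +
        ε * (B.f i k t * drift (B.q i) d k) < D.lam + t * D.h i ∧
      B.r i k + B.f i k t * B.deltaP D i k + ε * (B.f i k t * drift (B.q i) d k) <
        t * (D.lam + D.h i) :=
    eventually_all.2 fun k => (eventually_all_finset _).2 fun t ht =>
      (eventually_add_mul_lt (hD.switch i k t ht) fun h => hd k t ht (.inl h.symm)).and
        (eventually_add_mul_lt (hD.stay i k t ht) fun h => hd k t ht (.inr h.symm))
  obtain ⟨ε, hε⟩ := hev.exists
  refine ⟨D.p i + ε • d, fun k t ht => ?_⟩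
  obtain ⟨hswitch, hstay⟩ := hε k t ht
  rw [deltaP_eq_drift] at hswitch hstay
  simp only [map_add, map_smul, Pi.add_apply, Pi.smul_apply, smul_eq_mul]
  constructor <;> linarith

theorem Feasible.lam_le_reward_of_tight (hD : B.Feasible D) {i : ι} {k : S i} {t : ℕ}
    (ht : t ∈ B.W i k) (hf : B.f i k t = 0)
    (htight : B.SwitchTight D i k t ∨ B.StayTight D i k t) : D.lam ≤ B.r i k := by
  have hh := mul_nonneg t.cast_nonneg (hD.h_nonneg i)
  have hlam := le_mul_of_one_le_left hD.lam_nonneg (B.one_le_cast_of_mem ht)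
  rcases htight with h | h
  · rw [SwitchTight, hf, zero_mul] at h
    linarith [B.c_nonneg i, B.s_nonneg i]
  · rw [StayTight, hf, zero_mul] at h
    linarith

/-- Otherwise `p i` could be moved along a function with negative drift outside of the state without
tight constraint, which would make all constraints of the arm strict. -/
theorem Optimal.exists_absorbing (hD : B.Optimal D) {i : ι} (hi : 0 < D.h i)
    (hT : ¬ B.ArmTight D i) : ∃ k, B.f i k 1 = 0 ∧ D.lam ≤ B.r i k := by
  obtain ⟨k₀, hk₀⟩ : ∃ k₀, ∀ t ∈ B.W i k₀, ¬ (B.SwitchTight D i k₀ t ∨ B.StayTight D i k₀ t) := by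
    simpa only [ArmTight, not_forall, not_exists, not_and] using hT
  obtain ⟨d, -, hd⟩ :=
    exists_drift_eq_neg_one (B.q_nonneg i) fun k => B.strongly_connected i k k₀
  by_contra! hno
  suffices hneg : ∀ k, ∀ t ∈ B.W i k, B.SwitchTight D i k t ∨ B.StayTight D i k t →
      B.f i k t * drift (B.q i) d k < 0 by
    obtain ⟨v, hv⟩ := hD.1.exists_armStrict hneg
    exact hD.not_armStrict hi v hv
  intro k t ht htight
  have hk : k ≠ k₀ := fun h => hk₀ t (h ▸ ht) (h ▸ htight)
  have hf : B.f i k t ≠ 0 := fun hf => by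
    have hw := B.W_pos i k t ht
    have hf₁ : B.f i k 1 = 0 := (hf ▸ B.monotoneOn_f i k (Set.mem_Ici.2 le_rfl)
      (Set.mem_Ici.2 hw) hw).antisymm (B.f_nonneg i k 1 le_rfl)
    exact (hno k hf₁).not_ge (hD.1.lam_le_reward_of_tight ht hf htight)
  rw [hd k hk, mul_neg_one]
  exact neg_lt_zero.2 ((B.f_nonneg_of_mem ht).lt_of_ne' hf)

end Perturbation

section RepeatPlay

variable {B}

theorem eq_of_trans_pos {i : ι} {k j : S i} {t : ℕ} (hf : B.f i k t = 0)
    (h : 0 < B.trans i k t j) : j = k := by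
  by_contra hj
  rw [trans, if_neg hj, hf, zero_mul] at h
  exact h.false

open scoped Classical in
theorem le_total_repeatPlay {i : ι} {k : S i} (hf : B.f i k 1 = 0) {σ : ∀ l, S l} (hσ : σ i = k)
    (T : ℕ) : T * B.r i k + -B.s i ≤ B.total (repeatPlay S i) T [] (start σ) := by
  let I : Config ι S → Prop := fun x =>
    x.AgePos ∧ x.state i = k ∧ x.age i = 1 ∧ (x.last = none ∨ x.last = some i)
  let Φ : Config ι S → ℝ := fun x => if x.last = none then -B.s i else 0
  suffices h : T * B.r i k + (Φ (start σ) - 0) ≤ B.total (repeatPlay S i) T [] (start σ) by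
    simpa [Φ, start] using h
  refine B.le_total_of_potential (I := I) (fun x hx => hx.1) (fun x _ => ?_) ?_ ?_ T []
    ⟨agePos_start σ, hσ, rfl, .inl rfl⟩
  · simp only [Φ]
    split_ifs <;> linarith [B.s_nonneg i]
  · rintro H x y a ha ⟨hage, hstate, hone, -⟩ hxy
    cases (PMF.mem_support_pure_iff _ _).1 ha
    have hy := hxy.agePos hage
    cases hxy with
    | @play _ j hj =>
      rw [hstate, hone] at hj
      exact ⟨hy, by simpa [Config.play] using eq_of_trans_pos hf hj,
        by simp [Config.play], .inr rfl⟩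
  · rintro H x ⟨-, hstate, -, hlast⟩ a ha
    cases (PMF.mem_support_pure_iff _ _).1 ha
    have hΦ : ∀ j, Φ (x.play i j) = 0 := fun j => by simp [Φ, Config.play]
    simp only [stepValue, hΦ, mul_zero, Finset.sum_const_zero, hstate, Φ]
    rcases hlast with h | h <;> simp [h, switchCost, sub_eq_add_neg]

theorem Optimal.le_lowerAverage_repeatPlay {D : DualPoint ι S} (hD : B.Optimal D) {i : ι}
    (hi : 0 < D.h i) (hT : ¬ B.ArmTight D i) : ∃ k : S i, ∀ σ : ∀ l, S l, σ i = k →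
      (D.lam : EReal) ≤ B.lowerAverage (repeatPlay S i) σ := by
  obtain ⟨k, hf, hreward⟩ := hD.exists_absorbing hi hT
  exact ⟨k, fun σ hσ => (EReal.coe_le_coe_iff.2 hreward).trans
    (B.le_lowerAverage (le_total_repeatPlay hf hσ))⟩

end RepeatPlay

end MonotoneBandit

theorem mainTheorem8_general {ι : Type*} [Fintype ι] {S : ι → Type*} [∀ i, Fintype (S i)]
    [∀ i, Nonempty (S i)] (B : MonotoneBandit ι S) :
    (∃ D : MonotoneBandit.DualPoint ι S, B.Optimal D) ∧
    (∀ D : MonotoneBandit.DualPoint ι S, B.Optimal D → ∀ i, 0 < D.h i → ¬ B.ArmTight D i →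
      ∃ k : S i, ∀ σ : ∀ l, S l, σ i = k →
        B.optValue ≤ 2 * B.lowerAverage (MonotoneBandit.repeatPlay S i) σ) ∧
    ∀ D : MonotoneBandit.DualPoint ι S, B.Feasible D → (∀ i, 0 < D.h i → B.ArmTight D i) →
      (∃ π : MonotoneBandit.Policy ι S, B.IsBalancedIndex D π) ∧
      ∀ (π : MonotoneBandit.Policy ι S) (σ : ∀ l, S l), B.IsBalancedIndex D π →
        B.optValue ≤ 2 * B.lowerAverage π σ := by
  refine ⟨B.exists_optimal, fun D hD i hi hT => ?_, fun D hD hT =>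
    ⟨MonotoneBandit.exists_isBalancedIndex B D, fun π σ hπ =>
      hD.optValue_le_two_mul (hπ.le_lowerAverage hD hT σ)⟩⟩
  obtain ⟨k, hk⟩ := hD.le_lowerAverage_repeatPlay hi hT
  exact ⟨k, fun σ hσ => hD.1.optValue_le_two_mul (hk σ hσ)⟩
theorem mainTheorem8 {ι : Type*} [Fintype ι] {S : ι → Type*} [∀ i, Fintype (S i)]
    [∀ i, Nonempty (S i)] (B : MonotoneBandit ι S) :
    (∃ D : MonotoneBandit.DualPoint ι S, B.Optimal D) ∧
    ∀ D : MonotoneBandit.DualPoint ι S, B.Optimal D →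
      (∀ i, 0 < D.h i → ¬ B.ArmTight D i →
        ∃ k : S i, ∀ σ : ∀ l, S l, σ i = k →
          B.optValue ≤ 2 * B.lowerAverage (MonotoneBandit.repeatPlay S i) σ) ∧
      ((∀ i, 0 < D.h i → B.ArmTight D i) →
        (∃ π : MonotoneBandit.Policy ι S, B.IsBalancedIndex D π) ∧
        ∀ (π : MonotoneBandit.Policy ι S) (σ : ∀ l, S l), B.IsBalancedIndex D π →
          B.optValue ≤ 2 * B.lowerAverage π σ) := by
  obtain ⟨hopt, hrepeat, hindex⟩ := mainTheorem8_general B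
  exact ⟨hopt, fun D hD => ⟨hrepeat D hD, hindex D hD.1⟩⟩
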